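/- Let $n\ge 1$, let $A=(a_{ij})$ be a symmetric complex $n\times n$ matrix of rank $r$, and let $$\Delta_A=\sum_{i,j=1}^n a_{ij}\,\frac{\partial^2}{\partial z_i\,\partial z_j}$$ act on the ring $\mathbb{C}[[z_1,\dots,z_n]]$ of formal power series. Let $P\in\mathbb{C}[[z_1,\dots,z_n]]$ have order $o(P)\ge 2$, that is, all its terms of total degree less than $2$ vanish. Call $P$ $\Delta_A$-nilpotent if $\Delta_A^m(P^m)=0$ for every integer $m\ge 1$. Then $P$ is $\Delta_A$-nilpotent if and only if $\Delta_A^m(P^m)=0$ for every integer $m$ with $1\le m\le r$. -/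

import Mathlib

/-- The second order operator `Δ_A = ∑ i j, a i j • D i ∘ D j` with constant coefficients, acting
on the formal power series in `z_1, …, z_n` over `ℂ`, where `D i = ∂/∂z_i`. -/
noncomputable def laplaceOp {n : ℕ} (A : Matrix (Fin n) (Fin n) ℂ) :
    Module.End ℂ (MvPowerSeries (Fin n) ℂ) :=
  ∑ i : Fin n, ∑ j : Fin n, A i j •
    ((MvPowerSeries.pderiv ℂ i).toLinearMap ∘ₗ (MvPowerSeries.pderiv ℂ j).toLinearMap)

/-- For a linear operator `L` on power series, `P` is `L`-nilpotent if `L^m (P^m) = 0` for all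
`m ≥ 1`, where `L^m` is the `m`-fold composite and `P^m` the `m`-th power of the series. -/
def IsOpNilpotent {n : ℕ} (L : Module.End ℂ (MvPowerSeries (Fin n) ℂ))
    (P : MvPowerSeries (Fin n) ℂ) : Prop :=
  ∀ m : ℕ, 1 ≤ m → (L ^ m) (P ^ m) = 0

/-!
The condition on `Δ_A^m (P^m)` is compared with the traces of the powers of `H = A * Hess P`.

Let `Q` be the formal solution of the Hamilton–Jacobi equation `∂Q/∂t = ½ ⟨∇Q, A ∇Q⟩` with
`Q(0) = P` (`flow`), a power series in `t` with coefficients in `ℂ⟦z⟧`. Two facts hold along it.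

* The matrix `A * Hess Q` satisfies the Riccati equation `M' = M²` along the characteristics, so
  `tr(Mᵐ)' = m tr(Mᵐ⁺¹)` (`IsGradientPair.transport_mixedHessian`,
  `Derivation.trace_pow_of_riccati`). Hence, if `tr(Hᵐ) = 0` for `1 ≤ m < K`, then `Δ_A Q = tr M`
  vanishes to order `K - 1` in `t`, with leading coefficient a nonzero multiple of `tr(Hᴷ)`.
* `Δ_A (Q^(j+1)) = (j+1) (Q^j Δ_A Q + 2 ∂(Q^j)/∂t)` (`pairLaplacian_pow`). So, as long as `Δ_A Q`
  vanishes, each derivative in `t` of a power of `Q` trades for one `Δ_A` and one more factor `Q`,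
  and the coefficient of `t^(K-1)` in `Q` is a nonzero multiple of `Δ_A^(K-1) (P^K)`.

Applying `Δ_A` to the latter coefficient shows that, if `tr(Hᵐ) = 0` for `1 ≤ m < K`, then
`Δ_A^K (P^K)` and `tr(Hᴷ)` vanish together (`IsGradientPair.pairLaplacian_pow_pow_eq_zero_iff`).
By induction the hypothesis for `m ≤ r` gives `tr(Hᵐ) = 0` for `1 ≤ m ≤ r`. As `H` has rank at most
`r`, all `tr(Hᵐ)` with `m ≥ 1` then vanish (`Matrix.trace_pow_eq_zero_of_rank_le`), and the
equivalence, read backwards, gives `Δ_A^m (P^m) = 0` for every `m ≥ 1`.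
-/

/-! ### Traces of powers and rank -/

/-- Rank factorization: a matrix of rank at most `r` factors through `K ^ r`. -/
lemma Matrix.exists_eq_mul_of_rank_le {K m n : Type*} [Field K] [Fintype m] [Fintype n]
    (M : Matrix m n K) {r : ℕ} (hM : M.rank ≤ r) :
    ∃ (B : Matrix m (Fin r) K) (C : Matrix (Fin r) n K), M = B * C := by
  classical
  obtain ⟨f, hf⟩ := (finrank_le_iff_exists_linearMap (R := K)
    (M := LinearMap.range M.mulVecLin) (M' := Fin r → K)).1 (by simpa [Matrix.rank] using hM)
  obtain ⟨g, hg⟩ := f.exists_leftInverse_of_injective (LinearMap.ker_eq_bot.2 hf)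
  refine ⟨LinearMap.toMatrix' ((LinearMap.range M.mulVecLin).subtype ∘ₗ g),
    LinearMap.toMatrix' (f ∘ₗ M.mulVecLin.rangeRestrict), ?_⟩
  rw [← LinearMap.toMatrix'_comp]
  apply Matrix.toLin'.injective
  rw [Matrix.toLin'_toMatrix', Matrix.toLin'_apply']
  ext1 i
  ext1
  simp [LinearMap.comp_assoc, ← LinearMap.comp_assoc _ f g, hg]

lemma Matrix.trace_mul_pow_comm {R m n : Type*} [CommSemiring R] [Fintype m] [Fintype n]
    [DecidableEq m] [DecidableEq n] (B : Matrix m n R) (C : Matrix n m R) {k : ℕ} (hk : 1 ≤ k) :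
    ((B * C) ^ k).trace = ((C * B) ^ k).trace := by
  obtain ⟨k, rfl⟩ := Nat.exists_eq_add_of_le' hk
  have h : ∀ k : ℕ, (B * C) ^ k * B = B * (C * B) ^ k := by
    intro k
    induction k with
    | zero => simp
    | succ k ih => rw [pow_succ, Matrix.mul_assoc, Matrix.mul_assoc B C B, ← Matrix.mul_assoc, ih,
        Matrix.mul_assoc, ← pow_succ]
  rw [pow_succ, ← Matrix.mul_assoc, h, Matrix.mul_assoc, Matrix.trace_mul_comm, Matrix.mul_assoc,
    ← pow_succ]

/-- In characteristic zero a matrix of positive size whose powers up to its size are traceless is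
singular: taking the trace of the Cayley–Hamilton relation isolates the constant coefficient of
the characteristic polynomial. -/
lemma Matrix.det_eq_zero_of_trace_pow_eq_zero {K : Type*} [Field K] [CharZero K] {r : ℕ}
    (M : Matrix (Fin (r + 1)) (Fin (r + 1)) K)
    (h : ∀ k : ℕ, 1 ≤ k → k ≤ r + 1 → (M ^ k).trace = 0) : M.det = 0 := by
  have hd : M.charpoly.natDegree = r + 1 := by simp [Matrix.charpoly_natDegree_eq_dim]
  have hCH := congrArg Matrix.trace M.aeval_self_charpoly
  rw [Polynomial.aeval_eq_sum_range, Matrix.trace_sum, Matrix.trace_zero,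
    Finset.sum_eq_single 0] at hCH
  · rw [Matrix.det_eq_sign_charpoly_coeff]
    have : ((r : K) + 1) ≠ 0 := by exact_mod_cast r.succ_ne_zero
    simp [this] at hCH
    simp [hCH]
  · intro k hk hk0
    rw [Matrix.trace_smul, h k (Nat.one_le_iff_ne_zero.2 hk0)
      (by have := Finset.mem_range.1 hk; omega), smul_zero]
  · simp

lemma Matrix.rank_le_of_det_eq_zero {K : Type*} [Field K] {r : ℕ}
    (M : Matrix (Fin (r + 1)) (Fin (r + 1)) K) (h : M.det = 0) : M.rank ≤ r := by
  by_contra! hr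
  obtain ⟨v, hv, hMv⟩ := Matrix.exists_mulVec_eq_zero_iff.2 h
  have h1 := M.mulVecLin.finrank_range_add_finrank_ker
  have h2 : LinearMap.ker M.mulVecLin = ⊥ := by
    rw [← Submodule.finrank_eq_zero (R := K)]
    simp only [Matrix.rank, Module.finrank_fin_fun] at hr h1
    omega
  exact hv (LinearMap.ker_eq_bot'.1 h2 v hMv)

/-- In characteristic zero, if the first `r` powers of a matrix of rank at most `r` are traceless,
then so are all its positive powers. The proof is by descent on `r`: with `M = B * C` a rank
factorization, `C * B` has size `r`, has the same traces of powers as `M`, and is singular. -/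
lemma Matrix.trace_pow_eq_zero_of_rank_le {K : Type*} [Field K] [CharZero K] {r : ℕ} :
    ∀ {n : ℕ} (M : Matrix (Fin n) (Fin n) K), M.rank ≤ r →
      (∀ k : ℕ, 1 ≤ k → k ≤ r → (M ^ k).trace = 0) →
      ∀ k : ℕ, 1 ≤ k → (M ^ k).trace = 0 := by
  induction r with
  | zero =>
    intro n M hM _ k hk
    obtain ⟨B, C, rfl⟩ := M.exists_eq_mul_of_rank_le hM
    rw [Matrix.trace_mul_pow_comm B C hk]
    simp [Matrix.trace]
  | succ r ih =>
    intro n M hM h k hk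
    obtain ⟨B, C, rfl⟩ := M.exists_eq_mul_of_rank_le hM
    have h' : ∀ k : ℕ, 1 ≤ k → k ≤ r + 1 → ((C * B) ^ k).trace = 0 := fun k hk hkr ↦ by
      rw [← Matrix.trace_mul_pow_comm B C hk, h k hk hkr]
    rw [Matrix.trace_mul_pow_comm B C hk]
    exact ih (C * B) (Matrix.rank_le_of_det_eq_zero _ (Matrix.det_eq_zero_of_trace_pow_eq_zero _ h'))
      (fun k hk hkr ↦ h' k hk (by omega)) k hk

/-! ### The Hamilton–Jacobi flow -/

section Flow

variable {k S ι : Type*} [CommRing k] [CommRing S] [Algebra k S] [Fintype ι]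

/-- Two families of commuting derivations for which `⟨F, G⟩ = ∑ i, D i F * E i G` is symmetric.
The motivating case is `D i = ∂ᵢ` and `E i = ∑ j, A i j • ∂ⱼ` with `A` symmetric, so that the
second order operator attached to the pair is `Δ_A = ∑ i, E i ∘ D i`. -/
structure IsGradientPair (D E : ι → Derivation k S S) : Prop where
  comm : ∀ i j F, E i (D j F) = D j (E i F)
  comm_left : ∀ i j F, D i (D j F) = D j (D i F)
  comm_right : ∀ i j F, E i (E j F) = E j (E i F)
  symm : ∀ F G, ∑ i, D i F * E i G = ∑ i, E i F * D i G

/-- The matrix of mixed second derivatives `E i (D j Q)`; for the pair attached to a symmetric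
matrix `A` it is `A` times the Hessian of `Q`. -/
def mixedHessian (D E : ι → Derivation k S S) (Q : S) : Matrix ι ι S :=
  Matrix.of fun i j ↦ E i (D j Q)

/-- The second order operator `∑ i, E i ∘ D i` attached to two families of derivations. -/
def pairLaplacian (D E : ι → Derivation k S S) : Module.End k S :=
  ∑ i, (E i).toLinearMap ∘ₗ (D i).toLinearMap

lemma pairLaplacian_apply (D E : ι → Derivation k S S) (F : S) :
    pairLaplacian D E F = ∑ i, E i (D i F) := by
  simp [pairLaplacian]

lemma trace_mixedHessian (D E : ι → Derivation k S S) (Q : S) :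
    (mixedHessian D E Q).trace = pairLaplacian D E Q := by
  simp [mixedHessian, pairLaplacian_apply, Matrix.trace]

/-- The derivative along the characteristics of the Hamilton–Jacobi equation. -/
def transport (D E : ι → Derivation k S S) (T : Derivation k S S) (Q : S) : Derivation k S S :=
  T - ∑ i, E i Q • D i

lemma transport_apply (D E : ι → Derivation k S S) (T : Derivation k S S) (Q F : S) :
    transport D E T Q F = T F - ∑ i, E i Q * D i F := by
  simp only [transport, Derivation.sub_apply, ← Derivation.coeFnAddMonoidHom_apply, map_sum,
    Finset.sum_apply]
  simp

variable {D E : ι → Derivation k S S} {T : Derivation k S S} {Q : S}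

/-- If `∂Q/∂t = ½ ⟨Q, Q⟩`, then the Hessian of `Q` satisfies a Riccati equation along the
characteristics. -/
lemma IsGradientPair.transport_mixedHessian [DecidableEq ι] (h : IsGradientPair D E)
    (hTD : ∀ i F, T (D i F) = D i (T F)) (hTE : ∀ i F, T (E i F) = E i (T F))
    (h2 : IsUnit (2 : S)) (hQ : 2 * T Q = ∑ i, D i Q * E i Q) (b c : ι) :
    transport D E T Q (mixedHessian D E Q b c) = (mixedHessian D E Q ^ 2) b c := by
  have h1 : D c (T Q) = ∑ e, E e Q * D e (D c Q) := by
    apply h2.mul_left_cancel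
    have h3 : D c (2 * T Q) = 2 * D c (T Q) := by
      rw [two_mul, map_add, two_mul]
    rw [← h3, hQ, map_sum, two_mul]
    simp only [Derivation.leibniz, smul_eq_mul, Finset.sum_add_distrib]
    congr 1
    · rw [← h.symm]
      exact Finset.sum_congr rfl fun e _ ↦ by rw [h.comm]
    · exact Finset.sum_congr rfl fun e _ ↦ by rw [h.comm_left]
  rw [transport_apply, sub_eq_iff_eq_add]
  calc T (mixedHessian D E Q b c) = E b (D c (T Q)) := by
        simp only [mixedHessian, Matrix.of_apply, hTE, hTD]
    _ = ∑ e, E e Q * E b (D e (D c Q)) + ∑ e, D e (D c Q) * E e (E b Q) := by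
        simp only [h1, map_sum, Derivation.leibniz, smul_eq_mul, Finset.sum_add_distrib,
          h.comm_right b]
    _ = ∑ e, E e Q * D e (E b (D c Q)) + ∑ e, E e (D c Q) * D e (E b Q) := by
        rw [h.symm]
        simp only [h.comm b]
    _ = _ := by
        rw [add_comm]
        simp only [pow_two, Matrix.mul_apply, mixedHessian, Matrix.of_apply, h.comm b,
          mul_comm (E _ (D c Q))]

/-- A matrix solution of the Riccati equation `M' = M²` satisfies `tr(Mᵐ)' = m tr(Mᵐ⁺¹)`. -/
lemma Derivation.trace_pow_of_riccati [DecidableEq ι] (L : Derivation k S S) (M : Matrix ι ι S)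
    (hM : ∀ i j, L (M i j) = (M ^ 2) i j) (m : ℕ) :
    L (M ^ m).trace = m * (M ^ (m + 1)).trace := by
  have h : ∀ m : ℕ, ∀ i j, L ((M ^ m) i j) = m * (M ^ (m + 1)) i j := by
    intro m
    induction m with
    | zero => intro i j; by_cases hij : i = j <;> simp [hij]
    | succ m ih =>
      intro i j
      have h1 : (M ^ (m + 2)) i j = ∑ l, (M ^ m) i l * (M ^ 2) l j := by
        rw [pow_add, Matrix.mul_apply]
      have h2 : (M ^ (m + 2)) i j = ∑ l, (M ^ (m + 1)) i l * M l j := by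
        rw [pow_succ, Matrix.mul_apply]
      rw [pow_succ, Matrix.mul_apply, map_sum]
      simp only [Derivation.leibniz, smul_eq_mul, hM, ih, Finset.sum_add_distrib]
      rw [← h1, show m + 1 + 1 = m + 2 from rfl, Nat.cast_succ, add_mul, one_mul, add_comm,
        h2, Finset.mul_sum]
      congr 1
      exact Finset.sum_congr rfl fun l _ ↦ by ring
  simp only [Matrix.trace, Matrix.diag, map_sum, h, Finset.mul_sum]

lemma pairLaplacian_pow
    (hQ : 2 * T Q = ∑ i, D i Q * E i Q) (j : ℕ) :
    pairLaplacian D E (Q ^ (j + 1)) =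
      (j + 1) * (Q ^ j * pairLaplacian D E Q + 2 * T (Q ^ j)) := by
  have h1 : 2 * T (Q ^ j) = j * Q ^ (j - 1) * ∑ i, D i Q * E i Q := by
    rw [Derivation.leibniz_pow, nsmul_eq_mul, smul_eq_mul, ← hQ]
    ring
  rw [h1, pairLaplacian_apply, pairLaplacian_apply]
  simp only [Finset.mul_sum, mul_add, ← Finset.sum_add_distrib]
  refine Finset.sum_congr rfl fun i _ ↦ ?_
  have h3 : E i ((j + 1 : ℕ) : S) = 0 := Derivation.map_natCast _ _
  simp only [Derivation.leibniz_pow, nsmul_eq_mul, smul_eq_mul, Derivation.leibniz, h3]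
  simp only [Nat.add_sub_cancel, Nat.cast_succ]
  ring

end Flow

/-! ### Coefficientwise derivations and the formal flow -/

open PowerSeries in
/-- The extension of a derivation of `R` to `R⟦X⟧`, acting on each coefficient. -/
noncomputable def Derivation.mapPowerSeries {k R : Type*} [CommRing k] [CommRing R] [Algebra k R]
    (d : Derivation k R R) : Derivation k R⟦X⟧ R⟦X⟧ :=
  Derivation.mk'
    { toFun := fun f ↦ PowerSeries.mk fun i ↦ d (coeff i f)
      map_add' := fun f g ↦ by ext i; simp
      map_smul' := fun c f ↦ by ext i; simp }
    fun f g ↦ by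
      ext i
      have h : coeff i (g * PowerSeries.mk fun i ↦ d (coeff i f)) =
          ∑ x ∈ Finset.HasAntidiagonal.antidiagonal i, coeff x.2 g * d (coeff x.1 f) := by
        rw [mul_comm, coeff_mul]
        exact Finset.sum_congr rfl fun x _ ↦ by rw [coeff_mk, mul_comm]
      simp only [LinearMap.coe_mk, AddHom.coe_mk, coeff_mk, map_add, smul_eq_mul, h]
      simp [coeff_mul, map_sum, Finset.sum_add_distrib]

@[simp] lemma Derivation.coeff_mapPowerSeries {k R : Type*} [CommRing k] [CommRing R]
    [Algebra k R] (d : Derivation k R R) (f : PowerSeries R) (i : ℕ) :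
    PowerSeries.coeff i (d.mapPowerSeries f) = d (PowerSeries.coeff i f) := by
  simp [Derivation.mapPowerSeries]

section FormalFlow

open PowerSeries

variable {k R ι : Type*} [Field k] [CommRing R] [Algebra k R] [Fintype ι]
  {D E : ι → Derivation k R R}

lemma IsGradientPair.mapPowerSeries (h : IsGradientPair D E) :
    IsGradientPair (fun i ↦ (D i).mapPowerSeries) (fun i ↦ (E i).mapPowerSeries) where
  comm i j F := by ext; simp [h.comm]
  comm_left i j F := by ext; simp [h.comm_left i j]
  comm_right i j F := by ext; simp [h.comm_right i j]
  symm F G := by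
    ext m
    simp only [map_sum, coeff_mul, Derivation.coeff_mapPowerSeries]
    rw [Finset.sum_comm, Finset.sum_comm (s := Finset.univ)]
    exact Finset.sum_congr rfl fun x _ ↦ h.symm _ _

lemma coeff_pairLaplacian_mapPowerSeries (F : R⟦X⟧) (m : ℕ) :
    coeff m (pairLaplacian (fun i ↦ (D i).mapPowerSeries) (fun i ↦ (E i).mapPowerSeries) F) =
      pairLaplacian D E (coeff m F) := by
  simp [pairLaplacian_apply]

variable (D E) in
/-- The coefficients in `t` of the solution of `∂Q/∂t = ½ ∑ i, D i Q * E i Q`, `Q(0) = P`. -/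
noncomputable def flowCoeff (P : R) : ℕ → R
  | 0 => P
  | m + 1 => (2 * (m + 1) : k)⁻¹ •
      ∑ i : Fin (m + 1), ∑ e, D e (flowCoeff P i) * E e (flowCoeff P (m - i))

variable (D E) in
/-- The formal solution `Q` of the Hamilton–Jacobi equation `∂Q/∂t = ½ ∑ i, D i Q * E i Q` with
`Q(0) = P`, as a power series in the time variable. -/
noncomputable def flow (P : R) : R⟦X⟧ := PowerSeries.mk (flowCoeff D E P)

variable (k R) in
/-- The derivative with respect to the time variable, as a derivation over the ground field. -/
noncomputable def timeDeriv : Derivation k R⟦X⟧ R⟦X⟧ := (derivative R).restrictScalars k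

lemma coeff_timeDeriv (F : R⟦X⟧) (m : ℕ) :
    coeff m (timeDeriv k R F) = (m + 1 : k) • coeff (m + 1) F := by
  rw [Algebra.smul_def]
  simp [timeDeriv, coeff_derivative, mul_comm]

lemma coeff_zero_flow (P : R) : coeff 0 (flow D E P) = P := by
  simp [flow, flowCoeff, -coeff_zero_eq_constantCoeff]

lemma coeff_zero_trace_pow_flow [DecidableEq ι] (P : R) (m : ℕ) :
    coeff 0 ((mixedHessian (fun i ↦ (D i).mapPowerSeries) (fun i ↦ (E i).mapPowerSeries)
      (flow D E P)) ^ m).trace = ((mixedHessian D E P) ^ m).trace := by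
  have h : (mixedHessian (fun i ↦ (D i).mapPowerSeries) (fun i ↦ (E i).mapPowerSeries)
      (flow D E P)).map (constantCoeff (R := R)) = mixedHessian D E P := by
    ext i j
    simp only [mixedHessian, Matrix.map_apply, Matrix.of_apply]
    rw [← coeff_zero_eq_constantCoeff_apply, Derivation.coeff_mapPowerSeries,
      Derivation.coeff_mapPowerSeries, coeff_zero_flow]
  rw [coeff_zero_eq_constantCoeff_apply, ← h, AddMonoidHom.map_trace, ← RingHom.mapMatrix_apply,
    ← RingHom.mapMatrix_apply,
    map_pow]

lemma coeff_mul_eq_zero_of_le {F G : R⟦X⟧} {m : ℕ} (h : ∀ b ≤ m, coeff b G = 0) :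
    coeff m (F * G) = 0 := by
  rw [coeff_mul]
  exact Finset.sum_eq_zero fun x hx ↦ by
    rw [h x.2 (by have := Finset.HasAntidiagonal.mem_antidiagonal.1 hx; omega), mul_zero]

variable [CharZero k]

lemma two_mul_timeDeriv_flow (P : R) :
    2 * timeDeriv k R (flow D E P) =
      ∑ i, (D i).mapPowerSeries (flow D E P) * (E i).mapPowerSeries (flow D E P) := by
  ext m
  have h2 : (2 * (m + 1) : k) ≠ 0 := by exact_mod_cast (by positivity : 2 * (m + 1) ≠ 0)
  have h1 : coeff m (2 * timeDeriv k R (flow D E P)) =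
      (2 * (m + 1) : k) • coeff (m + 1) (flow D E P) := by
    rw [two_mul, map_add, coeff_timeDeriv, ← add_smul, two_mul]
  rw [h1, flow, coeff_mk, flowCoeff, smul_inv_smul₀ h2, Finset.sum_comm]
  simp only [map_sum, coeff_mul, Derivation.coeff_mapPowerSeries, coeff_mk]
  refine Finset.sum_congr rfl fun e _ ↦ ?_
  rw [Finset.Nat.sum_antidiagonal_eq_sum_range_succ
    (fun a b ↦ D e (flowCoeff D E P a) * E e (flowCoeff D E P b)), Finset.sum_range]

/-- The transport equation for `U m = tr(Hᵐ)`, read off on coefficients: the next coefficient of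
`U m` comes from `U (m + 1)` as soon as the previous coefficients of `U m` vanish. -/
lemma IsGradientPair.coeff_succ_trace_pow_flow [DecidableEq ι] (h : IsGradientPair D E) (P : R)
    {U : ℕ → R⟦X⟧} (hU : U = fun m ↦ ((mixedHessian (fun i ↦ (D i).mapPowerSeries)
      (fun i ↦ (E i).mapPowerSeries) (flow D E P)) ^ m).trace) {m i : ℕ}
    (h0 : ∀ b ≤ i, coeff b (U m) = 0) :
    coeff (i + 1) (U m) = ((m : k) / (i + 1)) • coeff i (U (m + 1)) := by
  have hi : (i + 1 : k) ≠ 0 := by exact_mod_cast i.succ_ne_zero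
  have h2 : IsUnit (2 : R⟦X⟧) := by
    simpa only [map_ofNat] using (IsUnit.mk0 (2 : k) two_ne_zero).map (algebraMap k R⟦X⟧)
  have hT : ∀ d : Derivation k R R, ∀ F, timeDeriv k R (d.mapPowerSeries F) =
      d.mapPowerSeries (timeDeriv k R F) := by
    intro d F
    ext m
    simp [coeff_timeDeriv]
  have key := Derivation.trace_pow_of_riccati _ _
    (h.mapPowerSeries.transport_mixedHessian (fun _ ↦ hT _) (fun _ ↦ hT _) h2
      (two_mul_timeDeriv_flow P)) m
  have hUm : ∀ m, U m = ((mixedHessian (fun i ↦ (D i).mapPowerSeries)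
      (fun i ↦ (E i).mapPowerSeries) (flow D E P)) ^ m).trace := fun m ↦ by rw [hU]
  rw [← hUm, ← hUm, transport_apply] at key
  have key' := congrArg (coeff i) key
  rw [map_sub, coeff_timeDeriv, map_sum, Finset.sum_eq_zero, sub_zero] at key'
  · rw [div_eq_inv_mul, mul_smul, eq_inv_smul_iff₀ hi, key', ← nsmul_eq_mul, map_nsmul,
      Nat.cast_smul_eq_nsmul]
  · intro e _
    exact coeff_mul_eq_zero_of_le fun b hb ↦ by simp [h0 b hb]

/-- If `tr(Hᵐ) = 0` at time `0` for `1 ≤ m < K`, then the expansion in time of `tr(Hᵐ)` starts in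
degree `K - m` at the earliest, with a nonzero multiple of `tr(Hᴷ)` at time `0`. -/
lemma IsGradientPair.coeff_trace_pow_flow [DecidableEq ι] (h : IsGradientPair D E) (P : R) {K : ℕ}
    (hK : ∀ m, 1 ≤ m → m < K → ((mixedHessian D E P) ^ m).trace = 0)
    {U : ℕ → R⟦X⟧} (hU : U = fun m ↦ ((mixedHessian (fun i ↦ (D i).mapPowerSeries)
      (fun i ↦ (E i).mapPowerSeries) (flow D E P)) ^ m).trace) :
    (∀ i m, 1 ≤ m → m + i < K → coeff i (U m) = 0) ∧
    (∀ i m, 1 ≤ m → m + i = K →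
      ∃ c : k, c ≠ 0 ∧ coeff i (U m) = c • ((mixedHessian D E P) ^ K).trace) := by
  have h0 : ∀ m, coeff 0 (U m) = ((mixedHessian D E P) ^ m).trace := fun m ↦ by
    rw [hU, coeff_zero_trace_pow_flow]
  have h1 : ∀ i m, 1 ≤ m → m + i < K → coeff i (U m) = 0 := by
    intro i
    induction i using Nat.strong_induction_on with
    | _ i ih =>
      intro m hm hmi
      rcases i with _ | i
      · rw [h0, hK m hm (by omega)]
      · rw [h.coeff_succ_trace_pow_flow P hU fun b hb ↦ ih b (by omega) m hm (by omega),
          ih i (by omega) (m + 1) (by omega) (by omega), smul_zero]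
  refine ⟨h1, fun i ↦ ?_⟩
  induction i with
  | zero =>
    rintro m hm rfl
    exact ⟨1, one_ne_zero, by rw [h0, one_smul]; rfl⟩
  | succ i ih =>
    intro m hm hmi
    obtain ⟨c, hc, h2⟩ := ih (m + 1) (by omega) (by omega)
    have hm' : (m : k) ≠ 0 := by exact_mod_cast (by omega : m ≠ 0)
    have hi : (i + 1 : k) ≠ 0 := by exact_mod_cast i.succ_ne_zero
    refine ⟨m / (i + 1) * c, mul_ne_zero (div_ne_zero hm' hi) hc, ?_⟩
    rw [h.coeff_succ_trace_pow_flow P hU fun b hb ↦ h1 b m hm (by omega), h2, mul_smul]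

/-- As long as the Laplacian of the flow vanishes to order `K` in time, the powers of the flow
expand in time like a solution of a heat equation. -/
lemma coeff_flow_pow (P : R) {K : ℕ}
    (hΔ : ∀ b < K, coeff b (pairLaplacian (fun i ↦ (D i).mapPowerSeries)
      (fun i ↦ (E i).mapPowerSeries) (flow D E P)) = 0) (i : ℕ) (hi : i ≤ K) (j : ℕ) :
    ∃ c : k, c ≠ 0 ∧ coeff i (flow D E P ^ j) = c • (pairLaplacian D E ^ i) (P ^ (i + j)) := by
  induction i generalizing j with
  | zero =>
    refine ⟨1, one_ne_zero, ?_⟩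
    rw [one_smul, pow_zero, zero_add, coeff_zero_eq_constantCoeff_apply, map_pow,
      ← coeff_zero_eq_constantCoeff_apply, coeff_zero_flow]
    rfl
  | succ i ih =>
    obtain ⟨c, hc, h1⟩ := ih (by omega) (j + 1)
    have hj : (j + 1 : k) * (2 * (i + 1)) ≠ 0 := by
      exact_mod_cast (by positivity : (j + 1) * (2 * (i + 1)) ≠ 0)
    have h2 := congrArg (coeff i) (pairLaplacian_pow (two_mul_timeDeriv_flow (D := D) (E := E) P) j)
    have h3 : ∀ F : R⟦X⟧, ((j : R⟦X⟧) + 1) * F = (j + 1 : k) • F := fun F ↦ by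
      rw [Algebra.smul_def, map_add, map_natCast, map_one]
    have h4 : ∀ F : R⟦X⟧, 2 * F = (2 : k) • F := fun F ↦ by
      rw [Algebra.smul_def, map_ofNat]
    rw [h3, h4, coeff_pairLaplacian_mapPowerSeries, h1] at h2
    simp only [coeff_smul, map_add, coeff_timeDeriv] at h2
    rw [coeff_mul_eq_zero_of_le fun b hb ↦ hΔ b (by omega), zero_add, smul_smul, smul_smul,
      mul_assoc] at h2
    refine ⟨_, mul_ne_zero (inv_ne_zero hj) hc, ?_⟩
    rw [mul_smul, eq_inv_smul_iff₀ hj, ← h2, map_smul, pow_succ', Module.End.mul_apply,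
      show i + 1 + j = i + (j + 1) by omega]

/-- If the traces `tr(Hᵐ)` vanish for `1 ≤ m < K`, then `Δᴷ(Pᴷ)` is a nonzero multiple of
`tr(Hᴷ)`: both are nonzero multiples of the coefficient of `t ^ (K - 1)` in the Laplacian of the
flow starting at `P`. -/
lemma IsGradientPair.pairLaplacian_pow_pow_eq_zero_iff [DecidableEq ι] (h : IsGradientPair D E)
    (P : R) {K : ℕ} (h1K : 1 ≤ K)
    (hK : ∀ m, 1 ≤ m → m < K → ((mixedHessian D E P) ^ m).trace = 0) :
    (pairLaplacian D E ^ K) (P ^ K) = 0 ↔ ((mixedHessian D E P) ^ K).trace = 0 := by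
  obtain ⟨K, rfl⟩ := Nat.exists_eq_add_of_le' h1K
  obtain ⟨h1, h2⟩ := h.coeff_trace_pow_flow P hK rfl
  obtain ⟨c, hc, h3⟩ := h2 K 1 le_rfl (add_comm _ _)
  obtain ⟨c', hc', h4⟩ := coeff_flow_pow P (D := D) (E := E) (K := K)
    (fun b hb ↦ by simpa only [pow_one, trace_mixedHessian] using h1 b 1 le_rfl (by omega)) K le_rfl 1
  rw [pow_one, trace_mixedHessian, coeff_pairLaplacian_mapPowerSeries, ← pow_one (flow D E P), h4,
    map_smul, ← Module.End.mul_apply, ← pow_succ'] at h3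
  rw [← smul_eq_zero_iff_right hc', h3, smul_eq_zero_iff_right hc]

end FormalFlow

/-! ### Gradient pairs from symmetric matrices -/

section LaplaceOp

variable {n : ℕ}

lemma MvPowerSeries.pderiv_comm {σ R : Type*} [CommSemiring R] (i j : σ) (F : MvPowerSeries σ R) :
    pderiv R i (pderiv R j F) = pderiv R j (pderiv R i F) := by
  classical
  rcases eq_or_ne i j with rfl | hij
  · rfl
  · ext d
    simp only [coeff_pderiv, Finsupp.add_apply, Finsupp.single_eq_of_ne hij,
      Finsupp.single_eq_of_ne hij.symm, add_zero, add_right_comm _ (Finsupp.single i 1)]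
    rw [mul_right_comm]

/-- The contraction `∑ j, A i j • ∂ⱼ` of the gradient with a row of `A`. -/
noncomputable def rowDeriv (A : Matrix (Fin n) (Fin n) ℂ) (i : Fin n) :
    Derivation ℂ (MvPowerSeries (Fin n) ℂ) (MvPowerSeries (Fin n) ℂ) :=
  ∑ j, A i j • MvPowerSeries.pderiv ℂ j

lemma rowDeriv_apply (A : Matrix (Fin n) (Fin n) ℂ) (i : Fin n) (F : MvPowerSeries (Fin n) ℂ) :
    rowDeriv A i F = ∑ j, A i j • MvPowerSeries.pderiv ℂ j F := by
  simp only [rowDeriv, ← Derivation.coeFnAddMonoidHom_apply, map_sum, Finset.sum_apply]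
  simp

lemma isGradientPair_rowDeriv {A : Matrix (Fin n) (Fin n) ℂ} (hA : A.IsSymm) :
    IsGradientPair (MvPowerSeries.pderiv ℂ) (rowDeriv A) where
  comm i j F := by simp [rowDeriv_apply, MvPowerSeries.pderiv_comm j]
  comm_left := MvPowerSeries.pderiv_comm
  comm_right i j F := by
    simp only [rowDeriv_apply, map_sum, Derivation.map_smul, Finset.smul_sum]
    rw [Finset.sum_comm]
    refine Finset.sum_congr rfl fun a _ ↦ Finset.sum_congr rfl fun b _ ↦ ?_
    rw [smul_comm, MvPowerSeries.pderiv_comm]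
  symm F G := by
    simp only [rowDeriv_apply, Finset.mul_sum, Finset.sum_mul]
    rw [Finset.sum_comm]
    refine Finset.sum_congr rfl fun a _ ↦ Finset.sum_congr rfl fun b _ ↦ ?_
    rw [hA.apply, mul_smul_comm, smul_mul_assoc]

lemma laplaceOp_eq_pairLaplacian (A : Matrix (Fin n) (Fin n) ℂ) :
    laplaceOp A = pairLaplacian (MvPowerSeries.pderiv ℂ) (rowDeriv A) := by
  ext1 F
  rw [pairLaplacian_apply]
  simp only [laplaceOp, rowDeriv_apply, LinearMap.sum_apply, LinearMap.smul_apply,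
    LinearMap.comp_apply, Derivation.coeFn_coe]
  exact Finset.sum_congr rfl fun i _ ↦ Finset.sum_congr rfl fun j _ ↦ by
    rw [MvPowerSeries.pderiv_comm]

/-- The first `rank A` traces of powers of `A` times the Hessian of `P` control all of them. -/
lemma trace_mixedHessian_pow_eq_zero (A : Matrix (Fin n) (Fin n) ℂ) (P : MvPowerSeries (Fin n) ℂ)
    (h : ∀ m : ℕ, 1 ≤ m → m ≤ A.rank →
      (mixedHessian (MvPowerSeries.pderiv ℂ) (rowDeriv A) P ^ m).trace = 0) (m : ℕ) (hm : 1 ≤ m) :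
    (mixedHessian (MvPowerSeries.pderiv ℂ) (rowDeriv A) P ^ m).trace = 0 := by
  let R := MvPowerSeries (Fin n) ℂ
  let K := FractionRing R
  have : CharZero R := algebraRat.charZero R
  have : CharZero K := algebraRat.charZero K
  set H := mixedHessian (MvPowerSeries.pderiv ℂ) (rowDeriv A) P with hH
  let φ : R →+* K := algebraMap R K
  have hφ : Function.Injective φ := IsFractionRing.injective R K
  have htr : ∀ m : ℕ, ((φ.mapMatrix H) ^ m).trace = φ (H ^ m).trace := fun m ↦ by
    rw [← map_pow, RingHom.mapMatrix_apply, ← AddMonoidHom.map_trace]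
  have hrank : (φ.mapMatrix H).rank ≤ A.rank := by
    obtain ⟨B, C, hBC⟩ := A.exists_eq_mul_of_rank_le le_rfl
    have hfac : H = (algebraMap ℂ R).mapMatrix A *
        Matrix.of fun i j ↦ MvPowerSeries.pderiv ℂ i (MvPowerSeries.pderiv ℂ j P) := by
      ext1 i j
      simp [hH, mixedHessian, rowDeriv_apply, Matrix.mul_apply, Algebra.smul_def]
      rfl
    rw [hfac, map_mul]
    refine (Matrix.rank_mul_le_left _ _).trans ?_
    have : φ.mapMatrix ((algebraMap ℂ R).mapMatrix A) =
        (B.map (φ.comp (algebraMap ℂ R))) * (C.map (φ.comp (algebraMap ℂ R))) := by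
      conv_lhs => rw [hBC]
      rw [← Matrix.map_mul]
      rfl
    rw [this]
    exact (Matrix.rank_mul_le_left _ _).trans (Matrix.rank_le_width _)
  apply hφ
  rw [map_zero, ← htr]
  exact Matrix.trace_pow_eq_zero_of_rank_le _ hrank
    (fun k hk hkr ↦ by rw [htr, h k hk hkr, map_zero]) m hm

end LaplaceOp

theorem proposition3p5 (n r : ℕ) (A : Matrix (Fin n) (Fin n) ℂ) (hA : A.IsSymm)
    (hr : A.rank = r) (P : MvPowerSeries (Fin n) ℂ) (hP : 2 ≤ P.order) :
    IsOpNilpotent (laplaceOp A) P ↔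
      ∀ m : ℕ, 1 ≤ m → m ≤ r → (laplaceOp A ^ m) (P ^ m) = 0 := by
  refine ⟨fun h m hm _ ↦ h m hm, fun h ↦ ?_⟩
  have hpair := isGradientPair_rowDeriv hA
  rw [laplaceOp_eq_pairLaplacian] at h ⊢
  have h1 : ∀ m : ℕ, 1 ≤ m → m ≤ r →
      (mixedHessian (MvPowerSeries.pderiv ℂ) (rowDeriv A) P ^ m).trace = 0 := by
    intro m
    induction m using Nat.strong_induction_on with
    | _ m ih =>
      intro hm hmr
      rw [← hpair.pairLaplacian_pow_pow_eq_zero_iff P hm fun l hl hlm ↦ ih l hlm hl (by omega)]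
      exact h m hm hmr
  have h2 := trace_mixedHessian_pow_eq_zero A P (hr ▸ h1)
  intro m hm
  rw [hpair.pairLaplacian_pow_pow_eq_zero_iff P hm fun l hl _ ↦ h2 l hl]
  exact h2 m hm
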